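/- Let $X$ be an arbitrary topological space. A path is a continuous map $[0,1]\to X$, and $\simeq$ denotes path-homotopy (homotopy relative to the endpoints). A set $A\subseteq[0,1]$ is a \emph{homotopy cut-set} for paths $\alpha,\beta:[0,1]\to X$ if $A$ is closed, nowhere dense and contains $\{0,1\}$, $\alpha|_A=\beta|_A$, and $\alpha|_{[a,b]}\simeq\beta|_{[a,b]}$ for every connected component $(a,b)$ of $[0,1]\setminus A$. The space $X$ has \emph{well-defined transfinite $\pi_1$-products} if for every $x\in X$, any two loops $\alpha,\beta$ based at $x$ that have a homotopy cut-set $A$ with $\alpha(A)=\beta(A)=\{x\}$ satisfy $\alpha\simeq\beta$. The \emph{algebraic $1$-wild set} $\mathbf{aw}(X)$ is the set of all $x\in X$ for which there is a sequence $(\gamma_n)_{n\in\mathbb N}$ of loops based at $x$, none of them path-homotopic to the constant loop, such that every neighborhood of $x$ contains $\gamma_n([0,1])$ for all but finitely many $n$. A subset of a topological space is \emph{dense-in-itself} if, with the subspace topology, it has no isolated points, and it is \emph{perfect} if it is closed and dense-in-itself. **Theorem.** Suppose $X$ has well-defined transfinite $\pi_1$-products and $x_0\in X\setminus\mathbf{aw}(X)$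 is a point such that $\{x_0\}$ is closed in $X$. If $A$ is a homotopy cut-set for loops $\alpha,\beta:[0,1]\to X$ based at $x_0$, then either $\alpha\simeq\beta$ or there exists a homotopy cut-set $B\subseteq A$ for $\alpha$ and $\beta$ such that 1. $B\setminus\{0,1\}$ is non-empty and perfect (in $[0,1]$), 2. $\alpha(B\setminus\{0,1\})=\beta(B\setminus\{0,1\})\subseteq\mathbf{aw}(X)$, 3. $\alpha(B\setminus\{0,1\})=\beta(B\setminus\{0,1\})$ is dense-in-itself. -/

import Mathlib

open Set Filter Topology unitInterval

/-- The points `a < b` of `A` are consecutive in `A`: no point of `A` lies strictly between them.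
For `A ⊆ [0,1]` closed with `0, 1 ∈ A`, the components of `[0,1] ∖ A` are exactly the intervals
`(a, b)` with `a, b` consecutive in `A`. -/
def ConsecutiveIn (A : Set I) (a b : I) : Prop :=
  a ∈ A ∧ b ∈ A ∧ a < b ∧ Disjoint (Ioo a b) A

/-- The restrictions of `α` and `β` to `[a, b]` (linearly reparametrized to `[0,1]`) are
path-homotopic, i.e. homotopic relative to the endpoints. In particular `α` and `β` agree at `a`
and at `b`. -/
def SubpathHomotopic {X : Type*} [TopologicalSpace X] {x y : X} (α β : Path x y) (a b : I) :
    Prop :=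
  ContinuousMap.HomotopicRel (α.subpath a b).toContinuousMap (β.subpath a b).toContinuousMap {0, 1}

/-- `A ⊆ [0,1]` is a homotopy cut-set for the paths `α` and `β`. -/
structure IsHomotopyCutSet {X : Type*} [TopologicalSpace X] {x y : X} (α β : Path x y)
    (A : Set I) : Prop where
  isClosed : IsClosed A
  isNowhereDense : IsNowhereDense A
  zero_mem : (0 : I) ∈ A
  one_mem : (1 : I) ∈ A
  eqOn : EqOn α β A
  homotopic : ∀ a b : I, ConsecutiveIn A a b → SubpathHomotopic α β a b

/-- Well-defined transfinite `π₁`-products at `x`: any two loops at `x` having a homotopy cut-set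
which they map entirely to `x` are path-homotopic. -/
def HasWellDefinedTransfinitePi1ProductsAt (X : Type*) [TopologicalSpace X] (x : X) : Prop :=
  ∀ (α β : Path x x) (A : Set I), IsHomotopyCutSet α β A → (∀ t ∈ A, α t = x) → α.Homotopic β

/-- Well-defined transfinite `π₁`-products (at every point of `X`). -/
def HasWellDefinedTransfinitePi1Products (X : Type*) [TopologicalSpace X] : Prop :=
  ∀ x : X, HasWellDefinedTransfinitePi1ProductsAt X x

/-- The algebraic 1-wild set `aw(X)`: the points `x` at which there is a null sequence (shrinking
to `x`) of non-trivial loops based at `x`. -/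
def algebraicWildSet (X : Type*) [TopologicalSpace X] : Set X :=
  {x | ∃ γ : ℕ → Path x x,
    (∀ U ∈ 𝓝 x, ∀ᶠ n in atTop, range (γ n) ⊆ U) ∧ ∀ n, ¬ (γ n).Homotopic (Path.refl x)}

/-! Relate two points of `A` when `α` and `β` are homotopic on the interval between them. This is an
equivalence relation on `A` that relates consecutive points, and its classes are closed in `A`.
Closedness is where transfinite products enter (`HomotopicOn.of_tendsto`). If `c n → a`, the values
at the `c n` vary, so the hypothesis, which concerns cut-sets mapped to one point, does not apply
directly. Detours from each `c n` to `a` and back create cut points that all map to `f a`;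
afterwards the detours are contracted inside the interval itself.

Call a point of `A` wild if arbitrarily near points of `A` are unrelated to it. Points with no wild
point strictly between them are related (`IsChainRelation.rel_of_Ioo`), so without wild points `α ≃
β`; otherwise the wild set `W` together with `{0, 1}` is the required `B`. An isolated wild point
could be bridged by transitivity, so `W` is perfect. Unrelated points converging to a wild point
give a null sequence of essential loops, so `W` maps into the algebraic wild set. If some image were
isolated, nearby wild points would share one value, and transfinite products would make the paths
homotopic there (`homotopicOn_of_wildPoints_subset`). -/

/-! ### Homotopy of two maps on a subinterval -/

section HomotopicOn

variable {X : Type*} [TopologicalSpace X]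

/-- The affine path in `[0,1]` from `a` to `b`. -/
def affinePath (a b : I) : Path a b where
  toFun := Set.Icc.convexComb a b
  continuous_toFun := by fun_prop
  source' := by simp
  target' := by simp

theorem range_affinePath (a b : I) : range (affinePath a b) = uIcc a b :=
  Path.range_subpathAux a b

/-- The restrictions of `f` and `g` to `[a, b]` are path-homotopic; `a ≤ b` is not required. -/
def HomotopicOn (f g : C(I, X)) (a b : I) : Prop :=
  ContinuousMap.HomotopicRel (f.comp (affinePath a b).toContinuousMap)
    (g.comp (affinePath a b).toContinuousMap) {0, 1}

theorem subpathHomotopic_iff {x y : X} (α β : Path x y) (a b : I) :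
    SubpathHomotopic α β a b ↔ HomotopicOn α.toContinuousMap β.toContinuousMap a b :=
  Iff.rfl

/-- Continuous self-maps of the interval with the same endpoints are homotopic rel endpoints. -/
theorem homotopicRel_of_endpoints {u v : C(I, I)} (h0 : u 0 = v 0) (h1 : u 1 = v 1) :
    ContinuousMap.HomotopicRel u v {0, 1} := by
  refine ⟨⟨⟨⟨fun x => Set.Icc.convexComb (u x.2) (v x.2) x.1, by fun_prop⟩, ?_, ?_⟩, ?_⟩⟩
  · intro x; simp
  · intro x; simp
  · rintro t x (rfl | rfl)
    · simp [← h0]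
    · simp [← h1]

namespace HomotopicOn

variable {f g h : C(I, X)} {a b c : I}

theorem eq_left (H : HomotopicOn f g a b) : f a = g a := by
  simpa using ContinuousMap.HomotopicRel.fst_eq_snd H (x := 0) (by simp)

theorem eq_right (H : HomotopicOn f g a b) : f b = g b := by
  simpa using ContinuousMap.HomotopicRel.fst_eq_snd H (x := 1) (by simp)

theorem iff_path (ha : f a = g a) (hb : f b = g b) :
    HomotopicOn f g a b ↔ ((affinePath a b).map f.continuous).Homotopic
      (((affinePath a b).map g.continuous).cast ha hb) :=
  Iff.rfl

protected theorem symm (H : HomotopicOn f g a b) : HomotopicOn g f a b :=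
  ContinuousMap.HomotopicRel.symm H

protected theorem trans (H : HomotopicOn f g a b) (H' : HomotopicOn g h a b) :
    HomotopicOn f h a b :=
  ContinuousMap.HomotopicRel.trans H H'

/-- Homotopy on `[a, b]` only depends on the values there, and is insensitive to
reparametrization. -/
theorem comp_iff {ψ ψ' : C(I, I)} (ha : ψ a = ψ' a) (hb : ψ b = ψ' b) :
    HomotopicOn (f.comp ψ) (g.comp ψ') a b ↔ HomotopicOn f g (ψ a) (ψ b) := by
  have key : ∀ (f : C(I, X)) (φ : C(I, I)), φ a = ψ a → φ b = ψ b →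
      ContinuousMap.HomotopicRel ((f.comp φ).comp (affinePath a b).toContinuousMap)
        (f.comp (affinePath (ψ a) (ψ b)).toContinuousMap) {0, 1} := by
    intro f φ h0 h1
    rw [ContinuousMap.comp_assoc]
    exact (homotopicRel_of_endpoints (by simp [h0]) (by simp [h1])).comp_continuousMap f
  exact ⟨fun H => ((key f ψ rfl rfl).symm.trans H).trans (key g ψ' ha.symm hb.symm),
    fun H => ((key f ψ rfl rfl).trans H).trans (key g ψ' ha.symm hb.symm).symm⟩

theorem congr {f' g' : C(I, X)} (hf : EqOn f f' (uIcc a b)) (hg : EqOn g g' (uIcc a b)) :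
    HomotopicOn f g a b ↔ HomotopicOn f' g' a b := by
  have key : ∀ {f f' : C(I, X)}, EqOn f f' (uIcc a b) →
      f.comp (affinePath a b).toContinuousMap = f'.comp (affinePath a b).toContinuousMap := by
    intro f f' h
    ext t
    exact h (by rw [← range_affinePath]; exact mem_range_self t)
  rw [HomotopicOn, HomotopicOn, key hf, key hg]

theorem of_eqOn (h : EqOn f g (uIcc a b)) : HomotopicOn f g a b :=
  (congr (fun _ _ => rfl) h).1 (ContinuousMap.HomotopicRel.refl _)

theorem refl_of_eq (h : f a = g a) : HomotopicOn f g a a :=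
  of_eqOn (by simpa [EqOn] using h)

theorem swap (H : HomotopicOn f g a b) : HomotopicOn f g b a := by
  have key : ∀ f : C(I, X), ((affinePath a b).map f.continuous).symm =
      (affinePath b a).map f.continuous := by
    intro f
    ext t
    simp [affinePath, Path.symm]
  have h := ((iff_path H.eq_left H.eq_right).1 H).symm₂
  rw [← Path.cast_symm, key, key] at h
  exact (iff_path H.eq_right H.eq_left).2 h

theorem concat (H : HomotopicOn f g a b) (H' : HomotopicOn f g b c) : HomotopicOn f g a c := by
  have h1 := (iff_path H.eq_left H.eq_right).1 H
  have h2 := (iff_path H'.eq_left H'.eq_right).1 H'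
  have h := h1.hcomp h2
  rw [← Path.cast_trans, ← Path.map_trans, ← Path.map_trans] at h
  have key : ∀ f : C(I, X), ContinuousMap.HomotopicRel
      (f.comp (affinePath a c).toContinuousMap)
      (f.comp ((affinePath a b).trans (affinePath b c)).toContinuousMap) {0, 1} := fun f =>
    (homotopicRel_of_endpoints (by simp) (by simp)).comp_continuousMap f
  exact ((key f).trans h).trans (key g).symm

end HomotopicOn

theorem homotopic_iff_homotopicOn {x y : X} (α β : Path x y) :
    α.Homotopic β ↔ HomotopicOn α.toContinuousMap β.toContinuousMap 0 1 := by
  have : (affinePath 0 1).toContinuousMap = ContinuousMap.id I := by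
    ext t
    simp [affinePath]
  rw [HomotopicOn, this]
  rfl

end HomotopicOn

/-! ### Dyadic sums of bumps and the detour maps -/

section DyadicSeries

/-- A series of rescaled bumps with dyadic weights is evaluated one bump at a time. -/
theorem exists_dyadic_series {f : ℝ → ℝ} (hf : Continuous f) {M : ℝ}
    (hM : ∀ w, 0 ≤ w → |f w| ≤ M) (h_low : ∀ w ≤ 3 / 4, f w = 0) (h_high : ∀ w, 3 / 2 ≤ w → f w = 0)
    {e : ℕ → ℝ} (he : ∀ n, |e n| ≤ (1 / 2) ^ n) :
    ∃ S : C(I, ℝ), S 0 = 0 ∧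
      ∀ (n : ℕ) (v : I) (w : ℝ), (v : ℝ) = (1 / 2) ^ n * w → 3 / 4 ≤ w → w ≤ 3 / 2 →
        S v = e n * f w := by
  refine ⟨⟨fun v : I => ∑' n : ℕ, e n * f (2 ^ n * v), ?_⟩, ?_, ?_⟩
  · refine continuous_tsum (u := fun n => (1 / 2 : ℝ) ^ n * M) (fun n => by fun_prop)
      ((summable_geometric_of_lt_one (by norm_num) (by norm_num)).mul_right M) fun n v => ?_
    rw [Real.norm_eq_abs, abs_mul]
    exact mul_le_mul (he n) (hM _ (mul_nonneg (by positivity) v.2.1)) (abs_nonneg _)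
      (by positivity)
  · simp [h_low 0 (by norm_num)]
  · intro n v w hv hw hw'
    have hpow : ∀ k : ℕ, (2 : ℝ) ^ k * (1 / 2) ^ k = 1 := fun k => by
      rw [← mul_pow]; norm_num
    have hvw : (2 : ℝ) ^ n * v = w := by rw [hv, ← mul_assoc, hpow, one_mul]
    -- For `k ≠ n`, `2 ^ k * v` differs from `w` by a factor of at least 2 either way, so it leaves
    -- the open interval `(3/4, 3/2)` and its term vanishes.
    have h := tsum_eq_single (L := .unconditional ℕ) (f := fun k : ℕ => e k * f (2 ^ k * v)) n fun k hk => by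
      rcases lt_or_gt_of_ne hk with h | h
      · obtain ⟨j, rfl⟩ := Nat.exists_eq_add_of_lt h
        have h1 : (2 : ℝ) ^ k * v * (2 * 2 ^ j) = w := by rw [← hvw]; ring
        have h2 : (1 : ℝ) ≤ 2 ^ j := one_le_pow₀ (by norm_num)
        have h3 : 0 ≤ (2 : ℝ) ^ k * v := mul_nonneg (by positivity) v.2.1
        rw [h_low _ (by nlinarith), mul_zero]
      · obtain ⟨j, rfl⟩ := Nat.exists_eq_add_of_lt h
        have h1 : (2 : ℝ) ^ (n + j + 1) * v = w * (2 * 2 ^ j) := by rw [← hvw]; ring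
        have h2 : (1 : ℝ) ≤ 2 ^ j := one_le_pow₀ (by norm_num)
        rw [h_high _ (by rw [h1]; nlinarith), mul_zero]
    simpa [hvw] using h

theorem exists_dyadic_scale {v : ℝ} (h0 : 0 < v) (h1 : v ≤ 1) :
    ∃ (n : ℕ) (w : ℝ), v = (1 / 2) ^ n * w ∧ 3 / 4 ≤ w ∧ w ≤ 3 / 2 := by
  obtain ⟨n, hn, hn'⟩ := exists_nat_pow_near (x := 3 / 2 / v) (y := 2)
    (by rw [le_div_iff₀ h0]; linarith) (by norm_num)
  rw [le_div_iff₀ h0] at hn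
  rw [div_lt_iff₀ h0, pow_succ] at hn'
  refine ⟨n, 2 ^ n * v, ?_, by linarith, hn⟩
  rw [← mul_assoc, ← mul_pow]
  norm_num

/-- The point `2⁻ⁿ` of the unit interval. -/
noncomputable def dyadic (n : ℕ) : I :=
  ⟨(1 / 2) ^ n, by positivity, pow_le_one₀ (by norm_num) (by norm_num)⟩

theorem tendsto_dyadic : Tendsto dyadic atTop (𝓝 0) := by
  rw [tendsto_subtype_rng]
  exact tendsto_pow_atTop_nhds_zero_of_lt_one (by norm_num) (by norm_num)

theorem isClosed_insert_range_dyadic : IsClosed (insert 0 (range dyadic)) :=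
  tendsto_dyadic.isCompact_insert_range.isClosed

theorem Set.Countable.interior_eq_empty_unitInterval {s : Set I} (hs : s.Countable) :
    interior s = ∅ := by
  by_contra h
  obtain ⟨a, b, hab, h'⟩ := isOpen_interior.exists_Ioo_subset (nonempty_iff_ne_empty.2 h)
  have h1 : (Ioo a b).Countable := hs.mono (h'.trans interior_subset)
  have h2 : (Subtype.val '' Ioo a b) = Ioo (a : ℝ) b := by
    ext x
    constructor
    · rintro ⟨y, hy, rfl⟩
      exact hy
    · intro hx
      exact ⟨⟨x, a.2.1.trans hx.1.le, hx.2.le.trans b.2.2⟩, hx, rfl⟩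
  have h3 := h1.image Subtype.val
  rw [h2, Cardinal.Real.Ioo_countable_iff] at h3
  exact absurd hab (not_lt.2 h3)

theorem consecutiveIn_insert_range_dyadic {p q : I}
    (h : ConsecutiveIn (insert 0 (range dyadic)) p q) :
    ∃ n, p = dyadic (n + 1) ∧ q = dyadic n := by
  obtain ⟨hp, hq, hpq, hd⟩ := h
  rcases hq with rfl | ⟨n, rfl⟩
  · exact absurd hpq (not_lt.2 p.2.1)
  refine ⟨n, ?_, rfl⟩
  have hlt : dyadic (n + 1) < dyadic n :=
    pow_lt_pow_right_of_lt_one₀ (a := (1 / 2 : ℝ)) (by norm_num) (by norm_num) (Nat.lt_succ_self n)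
  have hle : dyadic (n + 1) ≤ p := by
    by_contra! hlt'
    exact disjoint_left.1 hd ⟨hlt', hlt⟩ (mem_insert_of_mem _ (mem_range_self _))
  rcases hp with rfl | ⟨m, rfl⟩
  · exact absurd (show (0 : ℝ) < (1 / 2) ^ (n + 1) by positivity) (not_lt.2 hle)
  have hm : n < m := by
    by_contra! hmn
    exact absurd hpq (not_lt.2 (pow_le_pow_of_le_one (a := (1 / 2 : ℝ)) (by norm_num) (by norm_num) hmn))
  exact le_antisymm (pow_le_pow_of_le_one (a := (1 / 2 : ℝ)) (by norm_num) (by norm_num) hm) hle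

/-- Given points `c n` converging to `a`, there are self-maps `ψ`, `ψ₀` of the interval and a
control function `s` such that `ψ` travels from `c (n+1)` to `c n` where `s ≤ 0` and makes an
excursion from `c n` to `a` and back where `0 ≤ s`, while `ψ₀` omits these excursions. -/
theorem exists_excursions {a : I} {c : ℕ → I} (hc : ∀ n, |(c n : ℝ) - a| ≤ (1 / 2) ^ n) :
    ∃ (ψ ψ₀ : C(I, I)) (s : C(I, ℝ)),
      s 0 = 0 ∧ ψ 0 = a ∧ (∀ n, ψ (dyadic n) = a ∧ 0 ≤ s (dyadic n)) ∧
      (∀ v, s v ≤ 0 → ψ v = ψ₀ v) ∧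
      (∀ v, 0 ≤ s v → ψ₀ v = a ∨ ∃ n, ψ₀ v = c n) ∧
      ∃ q : ℕ → I, (∀ n, q n ≤ dyadic n) ∧ (∀ n, ψ (q n) = c n) ∧ (∀ n, s (q n) = 0) ∧
        (∀ n, ∀ v ∈ Icc (q n) (dyadic n), 0 ≤ s v) ∧
        ∀ n, ∃ p, dyadic (n + 1) ≤ p ∧ p ≤ q n ∧ ψ p = c (n + 1) ∧
          (∀ v ∈ Icc (dyadic (n + 1)) p, 0 ≤ s v) ∧ ∀ v ∈ Icc p (q n), s v ≤ 0 := by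
  set e : ℕ → ℝ := fun n => c n - a with he
  -- With `v = 2⁻ⁿ w`, this profile is 0 at `w = 1` (the map is at `a`), 1 at `w = 7/8` and `9/8`
  -- (at `c n`), and 0 again once `|w - 1| ≥ 1/4`.
  obtain ⟨P, hP0, hP⟩ := exists_dyadic_series (f := fun w => max 0 (1 - |8 * |w - 1| - 1|))
    (by fun_prop) (M := 1)
    (fun w _ => by
      rw [abs_of_nonneg (le_max_left _ _)]
      exact max_le (by norm_num) (by linarith [abs_nonneg (8 * |w - 1| - 1)]))
    (fun w hw => max_eq_left (by
      have := neg_abs_le (w - 1); have := le_abs_self (8 * |w - 1| - 1); linarith))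
    (fun w hw => max_eq_left (by
      have := le_abs_self (w - 1); have := le_abs_self (8 * |w - 1| - 1); linarith)) (e := e) hc
  -- The same profile with its central dip filled in: constantly 1 for `|w - 1| ≤ 1/8`.
  obtain ⟨Q, hQ0, hQ⟩ := exists_dyadic_series (f := fun w => min 1 (max 0 (2 - 8 * |w - 1|)))
    (by fun_prop) (M := 1)
    (fun w _ => by
      rw [abs_of_nonneg (le_min (by norm_num) (le_max_left _ _))]
      exact min_le_left _ _)
    (fun w hw => by
      rw [max_eq_left (by have := neg_abs_le (w - 1); linarith)]; norm_num)
    (fun w hw => by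
      rw [max_eq_left (by have := le_abs_self (w - 1); linarith)]; norm_num) (e := e) hc
  -- Then `H v - v = v * (max 0 (2 - 8 * |w - 1|) - 1)`, with the sign of `1/8 - |w - 1|` for `v >
  -- 0`; the factor `v` gives continuity at 0.
  obtain ⟨H, hH0, hH⟩ := exists_dyadic_series (f := fun w => w * max 0 (2 - 8 * |w - 1|))
    (by fun_prop) (M := 4)
    (fun w hw => by
      rw [abs_of_nonneg (mul_nonneg hw (le_max_left _ _))]
      rcases le_total w 2 with h | h
      · have : max 0 (2 - 8 * |w - 1|) ≤ 2 := max_le (by norm_num) (by linarith [abs_nonneg (w - 1)])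
        nlinarith [le_max_left 0 (2 - 8 * |w - 1|)]
      · rw [max_eq_left (by have := le_abs_self (w - 1); linarith)]; norm_num)
    (fun w hw => by
      rw [max_eq_left (by have := neg_abs_le (w - 1); linarith)]; norm_num)
    (fun w hw => by
      rw [max_eq_left (by have := le_abs_self (w - 1); linarith)]; norm_num)
    (e := fun n => (1 / 2) ^ n) (fun n => by rw [abs_of_nonneg (by positivity)])
  let pr : ℝ → I := projIcc 0 1 zero_le_one
  have hpr : Continuous pr := continuous_projIcc
  have pr_val : ∀ (x : I) (y : ℝ), y = x → pr y = x := fun x y h => by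
    rw [h]; exact projIcc_val zero_le_one x
  have hsign : ∀ (n : ℕ) (v : I) (w : ℝ), (v : ℝ) = (1 / 2) ^ n * w → 3 / 4 ≤ w → w ≤ 3 / 2 →
      H v - v = (1 / 2) ^ n * w * (max 0 (2 - 8 * |w - 1|) - 1) := by
    intro n v w h1 h2 h3
    rw [hH n v w h1 h2 h3, h1]; ring
  have hpos : ∀ (n : ℕ) (v : I) (w : ℝ), (v : ℝ) = (1 / 2) ^ n * w → 8 * |w - 1| ≤ 1 →
      0 ≤ H v - v := by
    intro n v w h1 h2
    have := neg_abs_le (w - 1); have := le_abs_self (w - 1)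
    rw [hsign n v w h1 (by linarith) (by linarith)]
    exact mul_nonneg (mul_nonneg (by positivity) (by linarith))
      (by linarith [le_max_right 0 (2 - 8 * |w - 1|)])
  have hneg : ∀ (n : ℕ) (v : I) (w : ℝ), (v : ℝ) = (1 / 2) ^ n * w → 3 / 4 ≤ w → w ≤ 3 / 2 →
      1 ≤ 8 * |w - 1| → H v - v ≤ 0 := by
    intro n v w h1 h2 h3 h4
    rw [hsign n v w h1 h2 h3]
    refine mul_nonpos_of_nonneg_of_nonpos (mul_nonneg (by positivity) (by linarith)) ?_
    linarith [max_le (show (0 : ℝ) ≤ 1 by norm_num) (show 2 - 8 * |w - 1| ≤ 1 by linarith)]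
  have hscale : ∀ v : I, v = 0 ∨ ∃ (n : ℕ) (w : ℝ), (v : ℝ) = (1 / 2) ^ n * w ∧
      3 / 4 ≤ w ∧ w ≤ 3 / 2 := by
    intro v
    rcases eq_or_ne v 0 with h | h
    · exact Or.inl h
    · exact Or.inr (exists_dyadic_scale (unitInterval.pos_iff_ne_zero.2 h) v.2.2)
  have hdy : ∀ n, ((dyadic n : I) : ℝ) = (1 / 2) ^ n * 1 := fun n => (mul_one _).symm
  let q : ℕ → I := fun n => ⟨(1 / 2) ^ n * (7 / 8), by positivity, by
    nlinarith [pow_le_one₀ (n := n) (show (0 : ℝ) ≤ 1 / 2 by norm_num) (by norm_num)]⟩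
  have hqv : ∀ n, ((q n : I) : ℝ) = (1 / 2) ^ n * (7 / 8) := fun _ => rfl
  let p : ℕ → I := fun n => ⟨(1 / 2) ^ (n + 1) * (9 / 8), by positivity, by
    rw [pow_succ]
    nlinarith [pow_le_one₀ (n := n) (show (0 : ℝ) ≤ 1 / 2 by norm_num) (by norm_num)]⟩
  have hpv : ∀ n, ((p n : I) : ℝ) = (1 / 2) ^ (n + 1) * (9 / 8) := fun _ => rfl
  have hpow : ∀ n : ℕ, (0 : ℝ) < (1 / 2) ^ n := fun n => by positivity
  have hw_of : ∀ (n : ℕ) (v : I), (v : ℝ) = (1 / 2) ^ n * (2 ^ n * v) := fun n v => by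
    rw [← mul_assoc, ← mul_pow]; norm_num
  refine ⟨⟨fun v => pr (a + P v), by fun_prop⟩, ⟨fun v => pr (a + Q v), by fun_prop⟩,
    ⟨fun v => H v - v, by fun_prop⟩, ?_, ?_, ?_, ?_, ?_, q, ?_, ?_, ?_, ?_, ?_⟩
  · simp [hH0]
  · exact pr_val _ _ (by rw [hP0, add_zero])
  · intro n
    refine ⟨pr_val _ _ ?_, hpos n _ 1 (hdy n) (by norm_num)⟩
    rw [hP n _ 1 (hdy n) (by norm_num) (by norm_num)]
    norm_num
  · intro v hv
    change H v - v ≤ 0 at hv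
    show pr _ = pr _
    congr 2
    rcases hscale v with rfl | ⟨n, w, h1, h2, h3⟩
    · rw [hP0, hQ0]
    · rw [hP n v w h1 h2 h3, hQ n v w h1 h2 h3]
      congr 1
      have h4 : 1 ≤ 8 * |w - 1| := by
        by_contra! h
        rw [hsign n v w h1 h2 h3] at hv
        have h5 := le_max_right 0 (2 - 8 * |w - 1|)
        have : 0 < (1 / 2 : ℝ) ^ n * w * (max 0 (2 - 8 * |w - 1|) - 1) :=
          mul_pos (mul_pos (hpow n) (by linarith)) (by linarith)
        linarith
      rw [abs_of_nonneg (by linarith), min_eq_right (max_le (by norm_num) (by linarith))]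
      congr 1; ring
  · intro v hv
    change 0 ≤ H v - v at hv
    rcases hscale v with rfl | ⟨n, w, h1, h2, h3⟩
    · exact Or.inl (pr_val _ _ (by rw [hQ0, add_zero]))
    · refine Or.inr ⟨n, pr_val _ _ ?_⟩
      rw [hQ n v w h1 h2 h3]
      have h4 : 8 * |w - 1| ≤ 1 := by
        by_contra! h
        rw [hsign n v w h1 h2 h3] at hv
        have h5 : max 0 (2 - 8 * |w - 1|) < 1 := max_lt (by norm_num) (by linarith)
        have : (1 / 2 : ℝ) ^ n * w * (max 0 (2 - 8 * |w - 1|) - 1) < 0 :=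
          mul_neg_of_pos_of_neg (mul_pos (hpow n) (by linarith)) (by linarith)
        linarith
      rw [min_eq_left ((by linarith : (1 : ℝ) ≤ 2 - 8 * |w - 1|).trans (le_max_right _ _))]
      simp [he]
  · intro n
    show (q n : ℝ) ≤ dyadic n
    rw [hqv, hdy]
    have := hpow n
    linarith
  · intro n
    refine pr_val _ _ ?_
    rw [hP n _ _ (hqv n) (by norm_num) (by norm_num)]
    norm_num [he, abs_of_nonpos]
  · intro n
    have := hsign n _ _ (hqv n) (by norm_num) (by norm_num)
    norm_num [abs_of_nonpos] at this
    simpa using this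
  · rintro n v ⟨h1, h2⟩
    change (q n : ℝ) ≤ v at h1
    change (v : ℝ) ≤ dyadic n at h2
    have h3 := hw_of n v
    rw [hqv, h3, mul_le_mul_iff_right₀ (hpow n)] at h1
    rw [hdy, h3, mul_le_mul_iff_right₀ (hpow n)] at h2
    refine hpos n v _ h3 ?_
    rw [abs_of_nonpos (by linarith)]
    linarith
  · intro n
    refine ⟨p n, ?_, ?_, ?_, ?_, ?_⟩
    · show (dyadic (n + 1) : ℝ) ≤ p n
      rw [hpv, hdy]
      have := hpow (n + 1)
      linarith
    · show (p n : ℝ) ≤ q n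
      rw [hpv, hqv, pow_succ]
      have := hpow n
      linarith
    · refine pr_val _ _ ?_
      rw [hP (n + 1) _ _ (hpv n) (by norm_num) (by norm_num)]
      norm_num [he]
    · rintro v ⟨h1, h2⟩
      change (dyadic (n + 1) : ℝ) ≤ v at h1
      change (v : ℝ) ≤ p n at h2
      have h3 := hw_of (n + 1) v
      rw [hdy, h3, mul_le_mul_iff_right₀ (hpow (n + 1))] at h1
      rw [hpv, h3, mul_le_mul_iff_right₀ (hpow (n + 1))] at h2
      refine hpos (n + 1) v _ h3 ?_
      rw [abs_of_nonneg (by linarith)]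
      linarith
    · rintro v ⟨h1, h2⟩
      change (p n : ℝ) ≤ v at h1
      change (v : ℝ) ≤ q n at h2
      have h3 := hw_of n v
      have h4 := hw_of (n + 1) v
      rw [hpv, h4, mul_le_mul_iff_right₀ (hpow (n + 1))] at h1
      rw [hqv, h3, mul_le_mul_iff_right₀ (hpow n)] at h2
      have h5 : (2 : ℝ) ^ (n + 1) * v = 2 * (2 ^ n * v) := by rw [pow_succ]; ring
      rcases le_total (3 / 4) ((2 : ℝ) ^ n * v) with h | h
      · refine hneg n v _ h3 h (by linarith) ?_
        rw [abs_of_nonpos (by linarith)]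
        linarith
      · refine hneg (n + 1) v _ h4 (by linarith) (by linarith) ?_
        rw [abs_of_nonneg (by linarith)]
        linarith

end DyadicSeries

/-! ### Passing to limits of homotopic subintervals -/

section Limit

variable {X : Type*} [TopologicalSpace X]

theorem HomotopicOn.of_homotopy {f g : C(I, X)} {a b : I} (K : C(I × I, X))
    (h0 : ∀ v, K (0, v) = f v) (h1 : ∀ v, K (1, v) = g v) (ha : ∀ t, K (t, a) = f a)
    (hb : ∀ t, K (t, b) = f b) : HomotopicOn f g a b := by
  refine ⟨⟨⟨K.comp ⟨fun x => (x.1, affinePath a b x.2), by fun_prop⟩, ?_, ?_⟩, ?_⟩⟩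
  · intro x; simp [h0]
  · intro x; simp [h1]
  · rintro t x (rfl | rfl)
    · simp [ha]
    · simp [hb]

/-- If transfinite products are well-defined at `f a`, the homotopies between `f` and `g` on
`[c 0, c n]` persist in the limit `c n → a`. -/
theorem HomotopicOn.of_tendsto {f g : C(I, X)} {a : I} {c : ℕ → I}
    (hX : HasWellDefinedTransfinitePi1ProductsAt X (f a))
    (hc : ∀ n, |(c n : ℝ) - a| ≤ (1 / 2) ^ n) (ha : f a = g a)
    (H : ∀ n, HomotopicOn f g (c 0) (c n)) : HomotopicOn f g (c 0) a := by
  obtain ⟨ψ, ψ₀, s, hs0, hψ0, hdy, hle, hge, q, hq, hψq, hsq, hqs, hp⟩ := exists_excursions hc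
  have hψ₀ : ∀ v, 0 ≤ s v → f (ψ₀ v) = g (ψ₀ v) := by
    intro v hv
    rcases hge v hv with h | ⟨n, h⟩
    · rw [h, ha]
    · rw [h, (H n).eq_right]
  -- All detours are contracted at once by straight lines in the interval before applying `f`, so no
  -- infinite concatenation of homotopies in `X` is needed. At time 0 it follows `f` on detours and
  -- `g` elsewhere; at time 1 it is `g ∘ ψ₀`, as `f = g` at `a` and the `c n`.
  let K : C(I × I, X) :=
    ⟨fun x => if s x.2 ≤ 0 then g (Set.Icc.convexComb (ψ x.2) (ψ₀ x.2) x.1)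
      else f (Set.Icc.convexComb (ψ x.2) (ψ₀ x.2) x.1), by
      refine Continuous.if_le (by fun_prop) (by fun_prop) (by fun_prop) continuous_const ?_
      intro x hx
      simp [hle _ hx.le, hψ₀ _ hx.ge]⟩
  let k : C(I, X) := K.comp ⟨fun v => (0, v), by fun_prop⟩
  have hk_neg : ∀ v, s v ≤ 0 → k v = g (ψ v) := by
    intro v hv
    simp [k, K, hv]
  have hk_pos : ∀ v, 0 ≤ s v → k v = f (ψ v) := by
    intro v hv
    rcases hv.eq_or_lt with h | h
    · rw [hk_neg v h.ge, hle v h.ge, hψ₀ v hv]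
    · simp [k, K, h.not_ge]
  have hK_zero : ∀ t v, s v = 0 → K (t, v) = k v := by
    intro t v hv
    simp [k, K, hv, hle v hv.le]
  have hkψ₀ : HomotopicOn k (g.comp ψ₀) 0 (q 0) := by
    refine HomotopicOn.of_homotopy K (fun v => rfl) (fun v => ?_) (fun t => hK_zero t _ hs0)
      fun t => hK_zero t _ (hsq 0)
    by_cases hv : s v ≤ 0
    · simp [K, hv]
    · simp [K, hv, hψ₀ v (not_le.1 hv).le]
  have hd0 : dyadic 0 = 1 := by simp [dyadic]
  have hk_dy : ∀ n, k (dyadic n) = f a := fun n => by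
    rw [hk_pos _ (hdy n).2, (hdy n).1]
  have hk0 : k 0 = f a := by rw [hk_neg _ hs0.le, hψ0, ha]
  let κ : Path (f a) (f a) := ⟨k, hk0, by rw [← hd0]; exact hk_dy 0⟩
  let φ : Path (f a) (f a) := ⟨f.comp ψ, by simp [hψ0], by
    have := (hdy 0).1
    rw [hd0] at this
    simp [this]⟩
  have hpos : ∀ u v : I, u ≤ v → (∀ x ∈ Icc u v, 0 ≤ s x) → HomotopicOn k (f.comp ψ) u v :=
    fun u v huv h => HomotopicOn.of_eqOn (by
      rw [uIcc_of_le huv]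
      exact fun x hx => hk_pos x (h x hx))
  have hcut : IsHomotopyCutSet κ φ (insert 0 (range dyadic)) := by
    refine ⟨isClosed_insert_range_dyadic, ?_, mem_insert _ _, ?_, ?_, ?_⟩
    · rw [isClosed_insert_range_dyadic.isNowhereDense_iff]
      exact ((countable_range _).insert _).interior_eq_empty_unitInterval
    · rw [← hd0]
      exact mem_insert_of_mem _ (mem_range_self _)
    · rintro v (rfl | ⟨n, rfl⟩)
      · simp
      · show k _ = f (ψ _)
        rw [hk_dy, (hdy n).1]
    · intro u v huv
      obtain ⟨n, rfl, rfl⟩ := consecutiveIn_insert_range_dyadic huv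
      rw [subpathHomotopic_iff]
      show HomotopicOn k (f.comp ψ) _ _
      obtain ⟨p, hp1, hpq, hψp, hps, hpqs⟩ := hp n
      refine ((hpos _ _ hp1 hps).concat ?_).concat (hpos _ _ (hq n) (hqs n))
      refine (HomotopicOn.congr (f := g.comp ψ) (g := f.comp ψ) ?_ (fun _ _ => rfl)).1 ?_
      · rw [uIcc_of_le hpq]
        exact fun x hx => (hk_neg x (hpqs x hx)).symm
      · rw [HomotopicOn.comp_iff rfl rfl, hψp, hψq]
        exact ((H (n + 1)).swap.concat (H n)).symm
  have hκφ : HomotopicOn k (f.comp ψ) 0 1 := by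
    refine (homotopic_iff_homotopicOn κ φ).1 (hX κ φ _ hcut ?_)
    rintro v (rfl | ⟨n, rfl⟩)
    · exact hk0
    · exact hk_dy n
  -- Drop the last stretch, from `c 0` back to `a`, on which both maps agree.
  have h1 : HomotopicOn k (f.comp ψ) 0 (q 0) := by
    refine hκφ.concat (hpos _ _ ?_ ?_).swap
    · exact (q 0).2.2
    · rw [← hd0]
      exact hqs 0
  have h2 : HomotopicOn (f.comp ψ) (g.comp ψ₀) 0 (q 0) := h1.symm.trans hkψ₀
  rw [HomotopicOn.comp_iff (hle 0 hs0.le) (hle (q 0) (hsq 0).le), hψ0, hψq] at h2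
  exact h2.swap

/-- The set of points reachable from `b` by homotopies between `f` and `g` is closed relative to
the coincidence set. -/
theorem HomotopicOn.of_mem_closure (hX : HasWellDefinedTransfinitePi1Products X) {f g : C(I, X)}
    {a b : I} (ha : f a = g a)
    (h : a ∈ closure {t | HomotopicOn f g b t}) : HomotopicOn f g b a := by
  have hc : ∀ n : ℕ, ∃ c : I, HomotopicOn f g b c ∧ |(c : ℝ) - a| ≤ (1 / 2) ^ n := by
    intro n
    obtain ⟨c, hc, hca⟩ := Metric.mem_closure_iff.1 h ((1 / 2) ^ n) (by positivity)
    refine ⟨c, hc, ?_⟩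
    rw [abs_sub_comm]
    exact hca.le
  choose c hc hca using hc
  exact (hc 0).concat (HomotopicOn.of_tendsto (hX _) hca ha fun n => (hc 0).swap.concat (hc n))

end Limit

/-! ### Chain relations and their wild points -/

section ConsecutiveRelation

/-- The points of `A` near which some points of `A` are not related to the given point. -/
def wildPoints (A : Set I) (P : I → I → Prop) : Set I :=
  {t | t ∈ A ∧ ∃ᶠ s in 𝓝[A] t, ¬ P t s}

/-- An equivalence relation on `A` with closed classes that relates consecutive points. -/
structure IsChainRelation (A : Set I) (P : I → I → Prop) : Prop where
  isClosed : IsClosed A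
  refl : ∀ t ∈ A, P t t
  symm : ∀ {s t}, P s t → P t s
  trans : ∀ {r s t}, P r s → P s t → P r t
  of_mem_closure : ∀ {a b}, a ∈ A → a ∈ closure {t | P b t} → P b a
  of_consecutive : ∀ {a b}, ConsecutiveIn A a b → P a b

variable {A : Set I} {P : I → I → Prop}

theorem wildPoints_subset : wildPoints A P ⊆ A := fun _ h => h.1

theorem eventually_of_notMem_wildPoints {t : I} (ht : t ∈ A) (h : t ∉ wildPoints A P) :
    ∀ᶠ s in 𝓝[A] t, P t s := by
  by_contra h'
  exact h ⟨ht, not_eventually.1 h'⟩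

namespace IsChainRelation

variable (h : IsChainRelation A P)

include h

/-- Near a non-wild point all points of `A` lie in its class, hence are related to one another, so
non-wildness is an open condition. -/
theorem isClosed_wildPoints : IsClosed (wildPoints A P) := by
  rw [← isOpen_compl_iff, isOpen_iff_eventually]
  intro t ht
  by_cases htA : t ∈ A
  · have h1 := eventually_of_notMem_wildPoints htA ht
    rw [eventually_nhdsWithin_iff] at h1
    filter_upwards [eventually_eventually_nhds.2 h1] with s hs hsw
    refine hsw.2 (eventually_nhdsWithin_iff.2 ?_)
    filter_upwards [hs] with r hr hrA
    exact not_not.2 (h.trans (h.symm (hs.self_of_nhds hsw.1)) (hr hrA))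
  · filter_upwards [h.isClosed.isOpen_compl.mem_nhds htA] with s hs hsw
    exact hs hsw.1

/-- Passing to the next point of `A` to the right. -/
theorem exists_next {c d : I} (hd : d ∈ A) (hcd : c < d) :
    ∃ e ∈ A, c ≤ e ∧ e ≤ d ∧ Disjoint (Ioo c e) A ∧ (e = c → c ∈ closure (A ∩ Ioc c d)) := by
  have hne : (A ∩ Ioc c d).Nonempty := ⟨d, hd, hcd, le_rfl⟩
  have hglb := isGLB_sInf (A ∩ Ioc c d)
  have hmem := hglb.mem_closure hne
  refine ⟨sInf (A ∩ Ioc c d), ?_, ?_, ?_, ?_, ?_⟩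
  · exact h.isClosed.closure_subset_iff.2 inter_subset_left hmem
  · exact hglb.2 fun x hx => hx.2.1.le
  · exact hglb.1 ⟨hd, hcd, le_rfl⟩
  · refine disjoint_left.2 fun x hx hxA => ?_
    have hxd : x ≤ d := hx.2.le.trans (hglb.1 ⟨hd, hcd, le_rfl⟩)
    exact absurd hx.2 (not_lt.2 (hglb.1 ⟨hxA, hx.1, hxd⟩))
  · intro he
    rwa [he] at hmem

/-- The class of `c` has a largest point in `[c, d]`. If it were less than `d`, it could be passed:
by consecutiveness if `A` has a next point, by non-wildness if `A` accumulates from the right. -/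
theorem rel_of_Ico {c d : I} (hc : c ∈ A) (hd : d ∈ A) (hcd : c ≤ d)
    (hw : ∀ t ∈ Ico c d, t ∉ wildPoints A P) : P c d := by
  have hclosed : IsClosed ({t | t ∈ A ∧ P c t} ∩ Icc c d) := by
    refine IsClosed.inter (isClosed_of_closure_subset fun t ht => ?_) isClosed_Icc
    have htA : t ∈ A := h.isClosed.closure_subset_iff.2 (fun x hx => hx.1) ht
    exact ⟨htA, h.of_mem_closure htA (closure_mono (fun x hx => hx.2) ht)⟩
  obtain ⟨s, ⟨⟨hsA, hs⟩, hcs, hsd⟩, hmax⟩ :=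
    hclosed.isCompact.exists_isGreatest ⟨c, ⟨hc, h.refl c hc⟩, left_mem_Icc.2 hcd⟩
  rcases hsd.eq_or_lt with rfl | hsd
  · exact hs
  exfalso
  obtain ⟨e, heA, hse, hed, hdisj, hcl⟩ := h.exists_next hd hsd
  rcases hse.eq_or_lt with rfl | hse
  · have h1 := eventually_nhdsWithin_iff.1
      (eventually_of_notMem_wildPoints hsA (hw s ⟨hcs, hsd⟩))
    obtain ⟨t, ht, htA, hst, htd⟩ := mem_closure_iff_nhds.1 (hcl rfl) _ h1
    exact absurd hst (not_lt.2 (hmax ⟨⟨htA, h.trans hs (ht htA)⟩, hcs.trans hst.le, htd⟩))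
  · exact absurd hse (not_lt.2 (hmax ⟨⟨heA, h.trans hs
      (h.of_consecutive ⟨hsA, heA, hse, hdisj⟩)⟩, hcs.trans hse.le, hed⟩))

/-- Points of `A` with no wild point strictly between them are related. -/
theorem rel_of_Ioo {c d : I} (hc : c ∈ A) (hd : d ∈ A) (hcd : c ≤ d)
    (hw : ∀ t ∈ Ioo c d, t ∉ wildPoints A P) : P c d := by
  rcases hcd.eq_or_lt with rfl | hcd
  · exact h.refl c hc
  have key : ∀ t ∈ A, t ∈ Ioc c d → P d t := fun t ht htcd =>
    h.symm (h.rel_of_Ico ht hd htcd.2 fun s hs => hw s ⟨htcd.1.trans_le hs.1, hs.2⟩)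
  -- The left endpoint may be wild, so if `A` accumulates at it from the right, closedness of the
  -- class of `d` is used instead.
  obtain ⟨e, heA, hce, hed, hdisj, hcl⟩ := h.exists_next hd hcd
  rcases hce.eq_or_lt with rfl | hce
  · exact h.symm (h.of_mem_closure hc (closure_mono (fun t ht => key t ht.1 ht.2) (hcl rfl)))
  · exact h.trans (h.of_consecutive ⟨hc, heA, hce, hdisj⟩) (h.symm (key e heA ⟨hce, hed⟩))

/-- A point of `A` is not wild if it has an order-convex neighborhood in which any two points of
`A` are related. -/
theorem notMem_wildPoints_of_nhds {t : I} {U : Set I} (hU : U ∈ 𝓝 t)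
    (hP : ∀ c ∈ A, ∀ d ∈ A, c ≤ d → Icc c d ⊆ U → P c d) : t ∉ wildPoints A P := by
  rintro ⟨htA, hf⟩
  refine hf (eventually_nhdsWithin_iff.2 ?_)
  filter_upwards [ordConnectedComponent_mem_nhds.2 hU] with s hs hsA
  rw [mem_ordConnectedComponent] at hs
  rcases le_total t s with hts | hts
  · exact not_not.2 (hP t htA s hsA hts (by rwa [uIcc_of_le hts] at hs))
  · exact not_not.2 (h.symm (hP s hsA t htA hts (by rwa [uIcc_of_ge hts] at hs)))

theorem preperfect_wildPoints : Preperfect (wildPoints A P) := by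
  intro t ht
  by_contra hacc
  rw [accPt_iff_nhds] at hacc
  push Not at hacc
  obtain ⟨U, hU, hUt⟩ := hacc
  refine h.notMem_wildPoints_of_nhds hU (fun c hc d hd hcd hsub => ?_) ht
  by_cases htcd : t ∈ Icc c d
  · refine h.trans (h.rel_of_Ioo hc ht.1 htcd.1 fun s hs hsw => ?_)
      (h.rel_of_Ioo ht.1 hd htcd.2 fun s hs hsw => ?_)
    · exact hs.2.ne (hUt s ⟨hsub ⟨hs.1.le, hs.2.le.trans htcd.2⟩, hsw⟩)
    · exact hs.1.ne' (hUt s ⟨hsub ⟨htcd.1.trans hs.1.le, hs.2.le⟩, hsw⟩)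
  · exact h.rel_of_Ioo hc hd hcd fun s hs hsw => htcd
      (hUt s ⟨hsub ⟨hs.1.le, hs.2.le⟩, hsw⟩ ▸ ⟨hs.1.le, hs.2.le⟩)

end IsChainRelation

end ConsecutiveRelation

/-! ### Wild points of a homotopy cut-set -/

section CutSets

variable {X : Type*} [TopologicalSpace X]

theorem Path.Homotopic.of_trans_symm {x y : X} {p q : Path x y}
    (h : (p.trans q.symm).Homotopic (Path.refl x)) : p.Homotopic q := by
  have h1 : p.Homotopic (p.trans (q.symm.trans q)) :=
    Path.Homotopic.trans ⟨(Path.Homotopy.transRefl p).symm⟩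
      ((Path.Homotopic.refl p).hcomp ⟨Path.Homotopy.reflSymmTrans q⟩)
  have h2 : (p.trans (q.symm.trans q)).Homotopic ((p.trans q.symm).trans q) :=
    ⟨(Path.Homotopy.transAssoc p q.symm q).symm⟩
  exact (h1.trans h2).trans ((h.hcomp (Path.Homotopic.refl q)).trans ⟨Path.Homotopy.reflTrans q⟩)

theorem mem_algebraicWildSet_of_mem_wildPoints {f g : C(I, X)} {A : Set I} (hfg : EqOn f g A)
    {t : I} (ht : t ∈ wildPoints A (HomotopicOn f g)) : f t ∈ algebraicWildSet X := by
  obtain ⟨htA, hf⟩ := ht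
  have hex : ∀ n : ℕ, ∃ s ∈ A, uIcc t s ⊆ Metric.ball t (1 / ((n : ℝ) + 1)) ∧
      ¬ HomotopicOn f g t s := by
    intro n
    have hU : Metric.ball t (1 / ((n : ℝ) + 1)) ∈ 𝓝 t := Metric.ball_mem_nhds _ (by positivity)
    have hev : ∀ᶠ s in 𝓝[A] t, s ∈ A ∧ uIcc t s ⊆ Metric.ball t (1 / ((n : ℝ) + 1)) :=
      eventually_mem_nhdsWithin.and
        (mem_nhdsWithin_of_mem_nhds (ordConnectedComponent_mem_nhds.2 hU))
    obtain ⟨s, hs, hsA, hsU⟩ := (hf.and_eventually hev).exists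
    exact ⟨s, hsA, hsU, hs⟩
  choose s hsA hsU hs using hex
  refine ⟨fun n => ((affinePath t (s n)).map f.continuous).trans
    (((affinePath t (s n)).map g.continuous).cast (hfg htA) (hfg (hsA n))).symm, ?_, ?_⟩
  · intro U hU
    have hV : f ⁻¹' U ∩ g ⁻¹' U ∈ 𝓝 t := by
      refine inter_mem (f.continuous.continuousAt hU) (g.continuous.continuousAt ?_)
      rwa [← hfg htA]
    obtain ⟨ε, hε, hball⟩ := Metric.mem_nhds_iff.1 hV
    filter_upwards [(tendsto_one_div_add_atTop_nhds_zero_nat (𝕜 := ℝ)).eventually_lt_const hε]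
      with n hn
    have hsub : uIcc t (s n) ⊆ f ⁻¹' U ∩ g ⁻¹' U :=
      (hsU n).trans ((Metric.ball_subset_ball hn.le).trans hball)
    rw [Path.trans_range, Path.symm_range]
    refine union_subset ?_ ?_
    · rintro _ ⟨r, rfl⟩
      exact (hsub (range_affinePath t (s n) ▸ mem_range_self r)).1
    · rintro _ ⟨r, rfl⟩
      exact (hsub (range_affinePath t (s n) ▸ mem_range_self r)).2
  · exact fun n hn => hs n ((HomotopicOn.iff_path (hfg htA) (hfg (hsA n))).2 hn.of_trans_symm)

namespace IsHomotopyCutSet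

variable {x y : X} {α β : Path x y} {A : Set I}

theorem isChainRelation (hX : HasWellDefinedTransfinitePi1Products X)
    (hA : IsHomotopyCutSet α β A) :
    IsChainRelation A (HomotopicOn α.toContinuousMap β.toContinuousMap) where
  isClosed := hA.isClosed
  refl _ ht := HomotopicOn.refl_of_eq (hA.eqOn ht)
  symm := HomotopicOn.swap
  trans := HomotopicOn.concat
  of_mem_closure ha h := HomotopicOn.of_mem_closure hX (hA.eqOn ha) h
  of_consecutive h := hA.homotopic _ _ h

/-- If the wild points in `[c, d]` all have the same image, `α` and `β` are homotopic on
`[c, d]`. -/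
theorem homotopicOn_of_wildPoints_subset (hX : HasWellDefinedTransfinitePi1Products X)
    (hA : IsHomotopyCutSet α β A) {c d : I} (hc : c ∈ A) (hd : d ∈ A) (hcd : c ≤ d) {z : X}
    (hz : ∀ t ∈ Icc c d,
      t ∈ wildPoints A (HomotopicOn α.toContinuousMap β.toContinuousMap) → α t = z) :
    HomotopicOn α.toContinuousMap β.toContinuousMap c d := by
  have hR := hA.isChainRelation hX
  set W := wildPoints A (HomotopicOn α.toContinuousMap β.toContinuousMap) with hW
  set E := W ∩ Icc c d with hE
  have hEc : IsCompact E := (hR.isClosed_wildPoints.inter isClosed_Icc).isCompact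
  have hEA : E ⊆ A := inter_subset_left.trans wildPoints_subset
  rcases E.eq_empty_or_nonempty with hemp | hne
  · exact hR.rel_of_Ioo hc hd hcd fun t ht htW =>
      (eq_empty_iff_forall_notMem.1 hemp t ⟨htW, ht.1.le, ht.2.le⟩).elim
  obtain ⟨m, hmE, hm⟩ := hEc.exists_isLeast hne
  obtain ⟨M, hME, hM⟩ := hEc.exists_isGreatest hne
  have h1 : HomotopicOn α.toContinuousMap β.toContinuousMap c m :=
    hR.rel_of_Ioo hc (hEA hmE) hmE.2.1 fun t ht htW =>
      absurd ht.2 (not_lt.2 (hm ⟨htW, ht.1.le, ht.2.le.trans hmE.2.2⟩))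
  have h2 : HomotopicOn α.toContinuousMap β.toContinuousMap M d :=
    hR.rel_of_Ioo (hEA hME) hd hME.2.2 fun t ht htW =>
      absurd ht.1 (not_lt.2 (hM ⟨htW, hME.2.1.trans ht.1.le, ht.2.le⟩))
  have hmM : m ≤ M := hm hME
  -- Clamping to `[m, M]` turns both paths into loops at `z`, with cut-set the wild points in `[c,
  -- d]` plus 0 and 1.
  let r : C(I, I) := ⟨fun v => max m (min M v), by fun_prop⟩
  have hr0 : r 0 = m := by
    simp [r]
  have hr1 : r 1 = M := by
    simp [r, unitInterval.le_one', hmM]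
  have hrE : ∀ v ∈ E, r v = v := fun v hv => by
    simp [r, min_eq_right (hM hv), max_eq_right (hm hv)]
  have hrmono : Monotone r := fun u v huv => max_le_max le_rfl (min_le_min le_rfl huv)
  let A' : Set I := insert 0 (insert 1 E)
  have hA'A : A' ⊆ A := insert_subset hA.zero_mem (insert_subset hA.one_mem hEA)
  have hrA' : ∀ v ∈ A', r v ∈ E := by
    rintro v (rfl | rfl | hv)
    · rwa [hr0]
    · rwa [hr1]
    · rwa [hrE v hv]
  have hαE : ∀ v ∈ E, α v = z := fun v hv => hz v hv.2 hv.1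
  have hβE : ∀ v ∈ E, β v = z := fun v hv => (hA.eqOn (hEA hv)).symm.trans (hαE v hv)
  let α' : Path z z := ⟨α.toContinuousMap.comp r, by simp [hr0, hαE m hmE],
    by simp [hr1, hαE M hME]⟩
  let β' : Path z z := ⟨β.toContinuousMap.comp r, by simp [hr0, hβE m hmE],
    by simp [hr1, hβE M hME]⟩
  have hcut : IsHomotopyCutSet α' β' A' := by
    refine ⟨((hEc.insert 1).insert 0).isClosed, hA.isNowhereDense.mono hA'A, mem_insert _ _,
      mem_insert_of_mem _ (mem_insert _ _), ?_, ?_⟩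
    · intro v hv
      exact (hαE _ (hrA' v hv)).trans (hβE _ (hrA' v hv)).symm
    · rintro u v ⟨hu, hv, huv, hdisj⟩
      rw [subpathHomotopic_iff]
      refine (HomotopicOn.comp_iff (ψ := r) (ψ' := r) rfl rfl).2 ?_
      refine hR.rel_of_Ioo (hEA (hrA' u hu)) (hEA (hrA' v hv)) (hrmono huv.le) fun s hs hsW => ?_
      have hsE : s ∈ E := ⟨hsW, (hrA' u hu).2.1.trans hs.1.le, hs.2.le.trans (hrA' v hv).2.2⟩
      rw [← hrE s hsE] at hs
      exact disjoint_left.1 hdisj ⟨hrmono.reflect_lt hs.1, hrmono.reflect_lt hs.2⟩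
        (mem_insert_of_mem _ (mem_insert_of_mem _ hsE))
  have h3 := (homotopic_iff_homotopicOn α' β').1
    (hX z α' β' A' hcut fun v hv => hαE _ (hrA' v hv))
  have h4 := (HomotopicOn.comp_iff (ψ := r) (ψ' := r) rfl rfl).1 h3
  rw [hr0, hr1] at h4
  exact (h1.concat h4).concat h2

theorem preperfect_image_wildPoints (hX : HasWellDefinedTransfinitePi1Products X)
    (hA : IsHomotopyCutSet α β A) :
    Preperfect (α '' wildPoints A (HomotopicOn α.toContinuousMap β.toContinuousMap)) := by
  rintro _ ⟨t, ht, rfl⟩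
  by_contra hacc
  rw [accPt_iff_nhds] at hacc
  push Not at hacc
  obtain ⟨U, hU, hUt⟩ := hacc
  refine (hA.isChainRelation hX).notMem_wildPoints_of_nhds (α.continuous.continuousAt hU)
    (fun c hc d hd hcd hsub => ?_) ht
  exact hA.homotopicOn_of_wildPoints_subset hX hc hd hcd fun s hs hsW =>
    hUt (α s) ⟨hsub hs, mem_image_of_mem _ hsW⟩

end IsHomotopyCutSet

end CutSets

theorem theorem4p1 {X : Type*} [TopologicalSpace X]
    (hX : HasWellDefinedTransfinitePi1Products X)
    (x₀ : X) (hx₀ : x₀ ∉ algebraicWildSet X) (hclosed : IsClosed ({x₀} : Set X))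
    (α β : Path x₀ x₀) (A : Set I) (hA : IsHomotopyCutSet α β A) :
    α.Homotopic β ∨
      ∃ B : Set I, B ⊆ A ∧ IsHomotopyCutSet α β B ∧
        (B \ {0, 1}).Nonempty ∧ Perfect (B \ {0, 1}) ∧
        α '' (B \ {0, 1}) = β '' (B \ {0, 1}) ∧
        α '' (B \ {0, 1}) ⊆ algebraicWildSet X ∧
        Preperfect (α '' (B \ {0, 1})) := by
  have hR := hA.isChainRelation hX
  have hwild : ∀ t ∈ wildPoints A (HomotopicOn α.toContinuousMap β.toContinuousMap),
      α t ∈ algebraicWildSet X := fun t ht => mem_algebraicWildSet_of_mem_wildPoints hA.eqOn ht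
  have hperf := hA.preperfect_image_wildPoints hX
  set W := wildPoints A (HomotopicOn α.toContinuousMap β.toContinuousMap) with hW
  have hWA : W ⊆ A := wildPoints_subset
  -- The base point is not in the algebraic wild set, so the endpoints are not wild and deleting
  -- them from `B` leaves exactly `W`.
  have h0 : (0 : I) ∉ W := fun h => hx₀ (by simpa using hwild 0 h)
  have h1 : (1 : I) ∉ W := fun h => hx₀ (by simpa using hwild 1 h)
  rcases W.eq_empty_or_nonempty with hemp | hne
  · left
    rw [homotopic_iff_homotopicOn]
    exact hR.rel_of_Ioo hA.zero_mem hA.one_mem zero_le_one fun t _ =>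
      eq_empty_iff_forall_notMem.1 hemp t
  right
  have hdiff : (W ∪ {0, 1}) \ {0, 1} = W := by
    rw [union_sdiff_right]
    refine sdiff_eq_left.2 (disjoint_left.2 ?_)
    rintro t ht (rfl | rfl)
    exacts [h0 ht, h1 ht]
  have hBA : W ∪ {0, 1} ⊆ A :=
    union_subset hWA (insert_subset hA.zero_mem (singleton_subset_iff.2 hA.one_mem))
  refine ⟨W ∪ {0, 1}, hBA, ?_, ?_⟩
  · refine ⟨hR.isClosed_wildPoints.union (toFinite _).isClosed, hA.isNowhereDense.mono hBA,
      by simp, by simp, hA.eqOn.mono hBA, ?_⟩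
    rintro a b ⟨ha, hb, hab, hdisj⟩
    exact hR.rel_of_Ioo (hBA ha) (hBA hb) hab.le fun t ht htW =>
      disjoint_left.1 hdisj ht (Or.inl htW)
  · rw [hdiff]
    refine ⟨hne, ⟨hR.isClosed_wildPoints, hR.preperfect_wildPoints⟩,
      (hA.eqOn.mono hWA).image_eq, image_subset_iff.2 hwild, hperf⟩
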